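/- Let $G$ be a compact (Hausdorff) group, $L^1(G)$ its group algebra (complex functions integrable for the normalized Haar measure, with convolution as product), and $\mathrm{ZL}^1(G)=\{f\in L^1(G): f*g=g*f \text{ for all } g\in L^1(G)\}$ its centre. For a Banach algebra $A$ let $A\hat\otimes A$ be the projective tensor product, let $m:A\hat\otimes A\to A$ be the bounded linear map with $m(b\otimes c)=bc$, and let $A$ act on $A\hat\otimes A$ by $a\cdot(b\otimes c)=(ab)\otimes c$ and $(b\otimes c)\cdot a=b\otimes(ca)$. A bounded approximate diagonal (b.a.d.) for $A$ is a bounded net $(\mu_\alpha)$ in $A\hat\otimes A$ such that $m(\mu_\alpha)a\to a$, $a\,m(\mu_\alpha)\to a$ and $a\cdot\mu_\alpha-\mu_\alpha\cdot a\to 0$ in norm for every $a\in A$. The algebra $A$ is amenable if it has a b.a.d., and its amenability constant is $$\mathrm{AM}(A)=\inf\Bigl\{\sup_\alpha\|\mu_\alpha\| : (\mu_\alpha)\text{ is a b.a.d. for }A\Bigr\}\in[0,\infty],\qquad \inf\emptyset=\infty .$$ If $N$ is a closed normal subgroup of $G$, then $$\mathrm{AM}(\mathrm{ZL}^1(G))\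 \ge\ \mathrm{AM}(\mathrm{ZL}^1(G/N)).$$ In particular, if $\mathrm{ZL}^1(G)$ is amenable, then $\mathrm{ZL}^1(G/N)$ is amenable. -/

import Mathlib

open MeasureTheory Filter Topology TensorProduct
open scoped ENNReal

set_option linter.unusedSectionVars false
set_option linter.style.haveILetI false

noncomputable section

/-! ### The projective tensor product of normed spaces -/

namespace ProjectiveTensor

variable (E F G : Type*) [NormedAddCommGroup E] [NormedSpace ℂ E]
  [NormedAddCommGroup F] [NormedSpace ℂ F] [NormedAddCommGroup G] [NormedSpace ℂ G]

variable {E F} in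
/-- `Represents l u` says that `u = ∑ xᵢ ⊗ yᵢ`, where `l` is the finite list of the pairs
`(xᵢ, yᵢ)`. -/
def Represents (l : List (E × F)) (u : E ⊗[ℂ] F) : Prop :=
  (l.map fun p => p.1 ⊗ₜ[ℂ] p.2).sum = u

variable {E F} in
/-- The cost `∑ ‖xᵢ‖ ‖yᵢ‖` of a finite list of pairs `(xᵢ, yᵢ)`. -/
def cost (l : List (E × F)) : ℝ := (l.map fun p => ‖p.1‖ * ‖p.2‖).sum

/-- The algebraic tensor product `E ⊗ F`, as a type that carries the projective norm. -/
def Alg : Type _ := E ⊗[ℂ] F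

instance : AddCommGroup (Alg E F) := inferInstanceAs (AddCommGroup (E ⊗[ℂ] F))
instance : Module ℂ (Alg E F) := inferInstanceAs (Module ℂ (E ⊗[ℂ] F))

/-- The projective norm: the infimum of `∑ ‖xᵢ‖ ‖yᵢ‖` over all representations
`u = ∑ xᵢ ⊗ yᵢ` as a finite sum of elementary tensors. -/
instance : Norm (Alg E F) := ⟨fun u => sInf {r | ∃ l : List (E × F), Represents l u ∧ cost l = r}⟩

variable {E F G}

theorem norm_def (u : Alg E F) :
    ‖u‖ = sInf {r | ∃ l : List (E × F), Represents l u ∧ cost l = r} := rfl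

theorem cost_nonneg (l : List (E × F)) : 0 ≤ cost l := by
  apply List.sum_nonneg
  simp only [List.mem_map]
  rintro _ ⟨p, -, rfl⟩
  positivity

theorem cost_append (l l' : List (E × F)) : cost (l ++ l') = cost l + cost l' := by
  simp [cost]

theorem bddBelow_cost (u : E ⊗[ℂ] F) :
    BddBelow {r | ∃ l : List (E × F), Represents l u ∧ cost l = r} :=
  ⟨0, by rintro _ ⟨l, -, rfl⟩; exact cost_nonneg l⟩

theorem exists_represents (u : E ⊗[ℂ] F) : ∃ l : List (E × F), Represents l u := by
  induction u with
  | zero => exact ⟨[], rfl⟩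
  | tmul x y => exact ⟨[(x, y)], by simp [Represents]⟩
  | add u v hu hv =>
    obtain ⟨l, rfl⟩ := hu
    obtain ⟨l', rfl⟩ := hv
    exact ⟨l ++ l', by simp [Represents]⟩

theorem norm_le_cost {u : Alg E F} {l : List (E × F)} (h : Represents l u) : ‖u‖ ≤ cost l :=
  csInf_le (bddBelow_cost u) ⟨l, h, rfl⟩

theorem le_norm {u : Alg E F} {c : ℝ} (h : ∀ l, Represents l u → c ≤ cost l) : c ≤ ‖u‖ := by
  obtain ⟨l, hl⟩ := exists_represents u
  refine le_csInf ⟨_, l, hl, rfl⟩ ?_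
  rintro _ ⟨l, hl, rfl⟩
  exact h l hl

theorem alg_norm_nonneg (u : Alg E F) : 0 ≤ ‖u‖ := le_norm fun l _ => cost_nonneg l

theorem alg_norm_smul_le (c : ℂ) (u : Alg E F) : ‖c • u‖ ≤ ‖c‖ * ‖u‖ := by
  have key : ∀ l, Represents l u → ‖c • u‖ ≤ ‖c‖ * cost l := by
    intro l hl
    have h : Represents (l.map fun p => (c • p.1, p.2)) (c • u) := by
      have hl' : (l.map fun p => p.1 ⊗ₜ[ℂ] p.2).sum = u := hl
      have hs : c • (l.map fun p => p.1 ⊗ₜ[ℂ] p.2).sum = c • (u : E ⊗[ℂ] F) :=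
        congrArg (c • ·) hl'
      refine Eq.trans ?_ hs
      rw [List.smul_sum, List.map_map, List.map_map]
      rfl
    refine (norm_le_cost h).trans (le_of_eq ?_)
    simp only [cost, List.map_map]
    rw [← List.sum_map_mul_left]
    congr 1
    apply List.map_congr_left
    intro p _
    simp [norm_smul, mul_assoc]
  rcases eq_or_ne c 0 with rfl | hc
  · obtain ⟨l, hl⟩ := exists_represents u
    simpa using key l hl
  · have hc' : 0 < ‖c‖ := norm_pos_iff.2 hc
    rw [mul_comm, ← div_le_iff₀ hc']
    exact le_norm fun l hl => by
      rw [div_le_iff₀ hc', mul_comm]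
      exact key l hl

theorem alg_norm_smul (c : ℂ) (u : Alg E F) : ‖c • u‖ = ‖c‖ * ‖u‖ := by
  refine le_antisymm (alg_norm_smul_le c u) ?_
  rcases eq_or_ne c 0 with rfl | hc
  · simpa using alg_norm_nonneg _
  · have hc' : 0 < ‖c‖ := norm_pos_iff.2 hc
    have h := alg_norm_smul_le c⁻¹ (c • u)
    rw [inv_smul_smul₀ hc, norm_inv, ← div_eq_inv_mul, le_div_iff₀ hc'] at h
    linarith

theorem alg_norm_add_le (u v : Alg E F) : ‖u + v‖ ≤ ‖u‖ + ‖v‖ := by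
  have key : ∀ l, Represents l u → ∀ l', Represents l' v → ‖u + v‖ ≤ cost l + cost l' := by
    intro l hl l' hl'
    rw [← cost_append]
    refine norm_le_cost ?_
    have h : (l.map fun p => p.1 ⊗ₜ[ℂ] p.2).sum = u := hl
    have h' : (l'.map fun p => p.1 ⊗ₜ[ℂ] p.2).sum = v := hl'
    simp only [Represents, List.map_append, List.sum_append]
    rw [h, h']
    rfl
  have h1 : ∀ l, Represents l u → ‖u + v‖ - cost l ≤ ‖v‖ := fun l hl =>
    le_norm fun l' hl' => by linarith [key l hl l' hl']
  have h2 : ‖u + v‖ - ‖v‖ ≤ ‖u‖ := le_norm fun l hl => by linarith [h1 l hl]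
  linarith

theorem core : SeminormedSpace.Core ℂ (Alg E F) where
  norm_nonneg := alg_norm_nonneg
  norm_smul := alg_norm_smul
  norm_triangle := alg_norm_add_le

instance : SeminormedAddCommGroup (Alg E F) := SeminormedAddCommGroup.ofCore core
instance : NormedSpace ℂ (Alg E F) where
  norm_smul_le c u := (alg_norm_smul c u).le

variable (E F) in
/-- The projective tensor product `E ⊗̂ F`: the completion of the algebraic tensor product in
the projective norm. -/
abbrev Proj : Type _ := UniformSpace.Completion (Alg E F)

/-- The canonical bilinear map `(x, y) ↦ x ⊗ y` into the algebraic tensor product. -/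
def algMk : E →ₗ[ℂ] F →ₗ[ℂ] Alg E F := TensorProduct.mk ℂ E F

theorem norm_algMk_le (x : E) (y : F) : ‖algMk x y‖ ≤ ‖x‖ * ‖y‖ := by
  have h : Represents [(x, y)] (x ⊗ₜ[ℂ] y) := by simp [Represents]
  simpa [cost] using norm_le_cost (u := algMk x y) h

variable (E F) in
/-- The elementary tensor `x ⊗ y` in `E ⊗̂ F`, as a bounded bilinear map of `(x, y)`. -/
def tmulL : E →L[ℂ] F →L[ℂ] Proj E F :=
  (ContinuousLinearMap.compL ℂ F (Alg E F) (Proj E F) UniformSpace.Completion.toComplL) ∘L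
    (LinearMap.mkContinuous₂ algMk 1 fun x y => by simpa using norm_algMk_le x y)

/-- The linear map on the algebraic tensor product induced by a bilinear map. -/
def algLift (B : E →L[ℂ] F →L[ℂ] G) : Alg E F →ₗ[ℂ] G :=
  TensorProduct.lift (ContinuousLinearMap.toLinearMap₁₂ B)

theorem norm_algLift_le (B : E →L[ℂ] F →L[ℂ] G) (u : Alg E F) :
    ‖algLift B u‖ ≤ ‖B‖ * ‖u‖ := by
  have key : ∀ l, Represents l u → ‖algLift B u‖ ≤ ‖B‖ * cost l := by
    intro l hl
    have hl' : (l.map fun p => p.1 ⊗ₜ[ℂ] p.2).sum = u := hl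
    rw [← hl']
    clear hl hl'
    induction l with
    | nil =>
      have : algLift B (0 : E ⊗[ℂ] F) = 0 := map_zero (algLift B)
      simp [cost, this]
    | cons p l ih =>
      have h1 : algLift B (((p :: l).map fun p => p.1 ⊗ₜ[ℂ] p.2).sum) =
          B p.1 p.2 + algLift B ((l.map fun p => p.1 ⊗ₜ[ℂ] p.2).sum) := by
        rw [List.map_cons, List.sum_cons]
        refine (map_add (algLift B) _ _).trans ?_
        rfl
      have h2 : cost (p :: l) = ‖p.1‖ * ‖p.2‖ + cost l := by simp [cost]
      rw [h1, h2, mul_add]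
      refine (norm_add_le _ _).trans (add_le_add ?_ ih)
      rw [← mul_assoc]
      exact B.le_opNorm₂ _ _
  rcases (norm_nonneg B).eq_or_lt with h0 | h0
  · obtain ⟨l, hl⟩ := exists_represents u
    have := key l hl
    rw [← h0] at this ⊢
    simpa using this
  · rw [mul_comm, ← div_le_iff₀ h0]
    exact le_norm fun l hl => by
      rw [div_le_iff₀ h0, mul_comm]
      exact key l hl

/-- The bounded linear map `E ⊗̂ F → G` that sends `x ⊗ y` to `B x y`, for a bounded bilinear
map `B` into a Banach space. -/
def lift [CompleteSpace G] (B : E →L[ℂ] F →L[ℂ] G) : Proj E F →L[ℂ] G :=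
  ((algLift B).mkContinuous ‖B‖ (norm_algLift_le B)).extend
    (UniformSpace.Completion.toComplL : Alg E F →L[ℂ] Proj E F)

theorem lift_tmulL [CompleteSpace G] (B : E →L[ℂ] F →L[ℂ] G) (x : E) (y : F) :
    lift B (tmulL E F x y) = B x y :=
  ContinuousLinearMap.extend_eq _ (UniformSpace.Completion.denseRange_coe)
    (UniformSpace.Completion.isUniformInducing_coe _) (algMk x y)

end ProjectiveTensor

/-! ### Amenability of Banach algebras and the amenability constant -/

namespace BanachAlgebra

open ProjectiveTensor

universe u

variable (A : Type u) [NonUnitalNormedRing A] [NormedSpace ℂ A] [IsScalarTower ℂ A A]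
  [SMulCommClass ℂ A A]

variable {A} in
/-- The left action of `A` on `A ⊗̂ A`, `a · (b ⊗ c) = (a b) ⊗ c`. -/
def leftAct (a : A) : Proj A A →L[ℂ] Proj A A :=
  lift ((tmulL A A) ∘L (ContinuousLinearMap.mul ℂ A a))

variable {A} in
/-- The right action of `A` on `A ⊗̂ A`, `(b ⊗ c) · a = b ⊗ (c a)`. -/
def rightAct (a : A) : Proj A A →L[ℂ] Proj A A :=
  lift ((tmulL A A).flip ∘L ((ContinuousLinearMap.mul ℂ A).flip a)).flip

theorem leftAct_tmulL (a b c : A) :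
    leftAct a (tmulL A A b c) = tmulL A A (a * b) c := by
  simp [leftAct, lift_tmulL]

theorem rightAct_tmulL (a b c : A) :
    rightAct a (tmulL A A b c) = tmulL A A b (c * a) := by
  simp [rightAct, lift_tmulL]

variable [CompleteSpace A]

/-- The multiplication map `m : A ⊗̂ A → A`, `m (b ⊗ c) = b c`. -/
def mulMap : Proj A A →L[ℂ] A := lift (ContinuousLinearMap.mul ℂ A)

theorem mulMap_tmulL (b c : A) : mulMap A (tmulL A A b c) = b * c := by
  simp [mulMap, lift_tmulL]

variable {A} in
/-- A bounded approximate diagonal of the Banach algebra `A`: a bounded net `(μ i)` in `A ⊗̂ A`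
with `m (μ i) a → a`, `a m (μ i) → a` and `a · μ i - μ i · a → 0` for every `a`. -/
structure IsBAD {ι : Type*} [Preorder ι] (μ : ι → Proj A A) : Prop where
  bounded : ∃ C : ℝ, ∀ i, ‖μ i‖ ≤ C
  mulMap_mul : ∀ a : A, Tendsto (fun i => mulMap A (μ i) * a) atTop (𝓝 a)
  mul_mulMap : ∀ a : A, Tendsto (fun i => a * mulMap A (μ i)) atTop (𝓝 a)
  comm : ∀ a : A, Tendsto (fun i => leftAct a (μ i) - rightAct a (μ i)) atTop (𝓝 0)

/-- `A` is amenable if it has a bounded approximate diagonal, indexed by some nonempty directed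
set. (Index sets in the universe of `A` suffice: from any net one extracts another, with values
among those of the first, that is indexed by `Finset A × ℕ`.) -/
def IsAmenable : Prop :=
  ∃ (ι : Type u) (_ : Preorder ι) (_ : IsDirectedOrder ι) (_ : Nonempty ι) (μ : ι → Proj A A),
    IsBAD μ

/-- The amenability constant of `A`: the infimum of `sup ‖μ i‖` over all bounded approximate
diagonals `(μ i)` of `A`, where the infimum of the empty set is `∞`. -/
def amenabilityConstant : ℝ≥0∞ :=
  sInf {C | ∃ (ι : Type u) (_ : Preorder ι) (_ : IsDirectedOrder ι) (_ : Nonempty ι)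
    (μ : ι → Proj A A), IsBAD μ ∧ C = ⨆ i, ‖μ i‖ₑ}

end BanachAlgebra

/-! ### The group algebra of a compact group -/

namespace GroupAlgebra

section Convolution

variable {G : Type*} [Group G] [TopologicalSpace G] [IsTopologicalGroup G] [CompactSpace G]
  [MeasurableSpace G] [BorelSpace G] (μ : Measure G) [IsProbabilityMeasure μ] [μ.Regular]
  [μ.IsMulLeftInvariant]

variable {μ} in
/-- The left translate `(L t f) s = f (t⁻¹ s)` of an integrable function. -/
def translate (t : G) (f : Lp ℂ 1 μ) : Lp ℂ 1 μ := DomMulAct.mk t⁻¹ • f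

theorem translate_ae (t : G) (f : Lp ℂ 1 μ) : translate t f =ᵐ[μ] fun s => f (t⁻¹ * s) :=
  DomMulAct.smul_Lp_ae_eq _ _

theorem translate_norm (t : G) (f : Lp ℂ 1 μ) : ‖translate t f‖ = ‖f‖ :=
  DomMulAct.norm_smul_Lp _ _

theorem translate_translate (s t : G) (f : Lp ℂ 1 μ) :
    translate s (translate t f) = translate (s * t) f := by
  simp only [translate, smul_smul, ← DomMulAct.mk_mul, mul_inv_rev]

theorem translate_continuous (f : Lp ℂ 1 μ) : Continuous fun t : G => translate t f := by
  have h : Continuous fun t : G => DomMulAct.mk t⁻¹ :=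
    DomMulAct.continuous_mk.comp continuous_inv
  haveI : Fact ((1 : ℝ≥0∞) ≠ ∞) := ⟨ENNReal.one_ne_top⟩
  exact h.smul continuous_const

/-- Left translation as a bounded operator. -/
def translateL (t : G) : Lp ℂ 1 μ →L[ℂ] Lp ℂ 1 μ :=
  LinearMap.mkContinuous
    { toFun := translate t
      map_add' := fun f g => DomMulAct.smul_Lp_add _ f g
      map_smul' := fun c f => smul_comm _ c f } 1
    (fun f => by rw [one_mul]; exact (translate_norm μ t f).le)

theorem conv_integrable (f g : Lp ℂ 1 μ) : Integrable (fun t => f t • translate t g) μ := by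
  have h1 : Integrable f μ := L1.integrable_coeFn f
  refine (h1.norm.mul_const ‖g‖).mono'
    (h1.aestronglyMeasurable.smul (translate_continuous μ g).aestronglyMeasurable_of_compactSpace)
    (Eventually.of_forall fun t => ?_)
  rw [norm_smul, translate_norm]

variable {μ} in
/-- The convolution `f ∗ g = ∫ f t • L t g dt`, i.e. `(f ∗ g) s = ∫ f t g (t⁻¹ s) dt`, of two
elements of `L¹`, as a Bochner integral in `L¹`. (In this form the definition is meaningful
also for groups that are not second countable, where `(s, t) ↦ f t g (t⁻¹ s)` need not be
measurable for the product σ-algebra.) -/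
def conv (f g : Lp ℂ 1 μ) : Lp ℂ 1 μ := ∫ t, f t • translate t g ∂μ

theorem conv_add (f g h : Lp ℂ 1 μ) : conv f (g + h) = conv f g + conv f h := by
  simp only [conv]
  rw [← integral_add (conv_integrable μ f g) (conv_integrable μ f h)]
  refine integral_congr_ae (Eventually.of_forall fun t => ?_)
  have : translate t (g + h) = translate t g + translate t h := map_add (translateL μ t) g h
  simp only [this, smul_add]

theorem add_conv (f g h : Lp ℂ 1 μ) : conv (f + g) h = conv f h + conv g h := by
  simp only [conv]
  rw [← integral_add (conv_integrable μ f h) (conv_integrable μ g h)]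
  refine integral_congr_ae ?_
  filter_upwards [Lp.coeFn_add f g] with t ht
  rw [ht, Pi.add_apply, add_smul]

theorem smul_conv (c : ℂ) (f g : Lp ℂ 1 μ) : conv (c • f) g = c • conv f g := by
  simp only [conv]
  rw [← integral_smul]
  refine integral_congr_ae ?_
  filter_upwards [Lp.coeFn_smul c f] with t ht
  rw [ht, Pi.smul_apply, smul_assoc]

theorem conv_smul (c : ℂ) (f g : Lp ℂ 1 μ) : conv f (c • g) = c • conv f g := by
  simp only [conv]
  rw [← integral_smul]
  refine integral_congr_ae (Eventually.of_forall fun t => ?_)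
  have : translate t (c • g) = c • translate t g := map_smul (translateL μ t) c g
  simp only [this]
  rw [smul_comm]

theorem norm_conv_le (f g : Lp ℂ 1 μ) : ‖conv f g‖ ≤ ‖f‖ * ‖g‖ := by
  refine (norm_integral_le_integral_norm _).trans (le_of_eq ?_)
  simp only [norm_smul, translate_norm]
  rw [integral_mul_const, ← L1.norm_eq_integral_norm]

/-- Convolution on the right, as a bounded operator. -/
def convRightL (h : Lp ℂ 1 μ) : Lp ℂ 1 μ →L[ℂ] Lp ℂ 1 μ :=
  LinearMap.mkContinuous
    { toFun := fun f => conv f h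
      map_add' := fun f g => add_conv μ f g h
      map_smul' := fun c f => smul_conv μ c f h } ‖h‖
    (fun f => by simpa [mul_comm] using norm_conv_le μ f h)

theorem translate_conv (s : G) (f g : Lp ℂ 1 μ) :
    conv (translate s f) g = translate s (conv f g) := by
  have h1 : translate s (conv f g) = ∫ t, f t • translate (s * t) g ∂μ := by
    refine ((translateL μ s).integral_comp_comm (conv_integrable μ f g)).symm.trans ?_
    refine integral_congr_ae (Eventually.of_forall fun t => ?_)
    simp only [map_smul]
    rw [← translate_translate]
    rfl
  rw [h1, conv]
  have h2 : (fun t => translate s f t • translate t g) =ᵐ[μ]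
      fun t => f (s⁻¹ * t) • translate t g := by
    filter_upwards [translate_ae μ s f] with t ht
    rw [ht]
  rw [integral_congr_ae h2,
    ← integral_mul_left_eq_self (fun t => f (s⁻¹ * t) • translate t g) s]
  simp only [inv_mul_cancel_left]

theorem conv_assoc (f g h : Lp ℂ 1 μ) : conv (conv f g) h = conv f (conv g h) := by
  refine ((convRightL μ h).integral_comp_comm (conv_integrable μ f g)).symm.trans ?_
  refine integral_congr_ae (Eventually.of_forall fun t => ?_)
  simp only [map_smul]
  rw [← translate_conv]
  rfl

end Convolution

section Compact

variable (G : Type*) [Group G] [TopologicalSpace G] [IsTopologicalGroup G] [CompactSpace G]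

/-- The Haar measure of total mass `1` of a compact group, on its Borel σ-algebra. -/
def haarProb : @Measure G (borel G) :=
  letI : MeasurableSpace G := borel G
  haveI : BorelSpace G := ⟨rfl⟩
  Measure.haarMeasure ⊤

instance haarProb_isProbabilityMeasure :
    @IsProbabilityMeasure G (borel G) (haarProb G) :=
  letI : MeasurableSpace G := borel G
  haveI : BorelSpace G := ⟨rfl⟩
  ⟨Measure.haarMeasure_self⟩

instance haarProb_regular :
    @Measure.Regular G (borel G) _ (haarProb G) :=
  letI : MeasurableSpace G := borel G
  haveI : BorelSpace G := ⟨rfl⟩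
  Measure.regular_haarMeasure

instance haarProb_isMulLeftInvariant :
    @Measure.IsMulLeftInvariant G (borel G) _ (haarProb G) :=
  letI : MeasurableSpace G := borel G
  haveI : BorelSpace G := ⟨rfl⟩
  Measure.isMulLeftInvariant_haarMeasure ⊤

/-- The Banach space `L¹(G)` of a compact group `G`: (classes of) complex-valued functions that
are integrable for the normalized Haar measure, with the `L¹` norm. -/
def GroupL1 : Type _ := @Lp G ℂ (borel G) _ 1 (haarProb G)

instance : NormedAddCommGroup (GroupL1 G) :=
  inferInstanceAs (NormedAddCommGroup (@Lp G ℂ (borel G) _ 1 (haarProb G)))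

instance : NormedSpace ℂ (GroupL1 G) :=
  inferInstanceAs (NormedSpace ℂ (@Lp G ℂ (borel G) _ 1 (haarProb G)))

instance : CompleteSpace (GroupL1 G) :=
  inferInstanceAs (CompleteSpace (@Lp G ℂ (borel G) _ 1 (haarProb G)))

/-- The product of the group algebra is convolution. -/
instance : Mul (GroupL1 G) where
  mul f g :=
    letI : MeasurableSpace G := borel G
    haveI : BorelSpace G := ⟨rfl⟩
    conv (μ := haarProb G) f g

/-- `L¹(G)` with convolution is a normed ring. -/
instance : NonUnitalNormedRing (GroupL1 G) where
  __ := (inferInstance : NormedAddCommGroup (GroupL1 G))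
  __ := (inferInstance : Mul (GroupL1 G))
  left_distrib f g h :=
    letI : MeasurableSpace G := borel G
    haveI : BorelSpace G := ⟨rfl⟩
    conv_add (haarProb G) f g h
  right_distrib f g h :=
    letI : MeasurableSpace G := borel G
    haveI : BorelSpace G := ⟨rfl⟩
    add_conv (haarProb G) f g h
  zero_mul f := by
    letI : MeasurableSpace G := borel G
    haveI : BorelSpace G := ⟨rfl⟩
    exact map_zero (convRightL (haarProb G) f)
  mul_zero f := by
    letI : MeasurableSpace G := borel G
    haveI : BorelSpace G := ⟨rfl⟩
    have h := conv_smul (haarProb G) 0 f (0 : Lp ℂ 1 (haarProb G))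
    rw [zero_smul, zero_smul] at h
    exact h
  mul_assoc f g h :=
    letI : MeasurableSpace G := borel G
    haveI : BorelSpace G := ⟨rfl⟩
    conv_assoc (haarProb G) f g h
  norm_mul_le f g :=
    letI : MeasurableSpace G := borel G
    haveI : BorelSpace G := ⟨rfl⟩
    norm_conv_le (haarProb G) f g

instance : IsScalarTower ℂ (GroupL1 G) (GroupL1 G) :=
  ⟨fun c f g =>
    letI : MeasurableSpace G := borel G
    haveI : BorelSpace G := ⟨rfl⟩
    smul_conv (haarProb G) c f g⟩

instance : SMulCommClass ℂ (GroupL1 G) (GroupL1 G) :=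
  ⟨fun c f g =>
    letI : MeasurableSpace G := borel G
    haveI : BorelSpace G := ⟨rfl⟩
    (conv_smul (haarProb G) c f g).symm⟩

/-- `ZL¹(G)`, the centre of the group algebra: all `f` with `f ∗ g = g ∗ f` for every
`g` in `L¹(G)`. -/
abbrev ZL1 : Type _ := NonUnitalSubalgebra.center ℂ (GroupL1 G)

instance : NormedSpace ℂ (ZL1 G) where
  norm_smul_le c f := norm_smul_le c (f : GroupL1 G)

instance : CompleteSpace (ZL1 G) := by
  have h : IsClosed {f : GroupL1 G | ∀ g, g * f = f * g} := by
    rw [Set.ofPred_forall]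
    exact isClosed_iInter fun g =>
      isClosed_eq (by fun_prop) (by fun_prop)
  have h' : ((NonUnitalSubalgebra.center ℂ (GroupL1 G) : Set (GroupL1 G))) =
      {f : GroupL1 G | ∀ g, g * f = f * g} := by
    ext f
    exact NonUnitalSubalgebra.mem_center_iff
  exact (h' ▸ h : IsClosed (NonUnitalSubalgebra.center ℂ (GroupL1 G) : Set (GroupL1 G))).completeSpace_coe

end Compact

end GroupAlgebra

end

/-!
The proof rests on two facts.

A surjective contractive homomorphism `φ : A → B` of Banach algebras gives `AM(B) ≤ AM(A)`: the
contraction `φ ⊗ φ` intertwines the multiplication maps and the module actions, so it carries a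
bounded approximate diagonal of `A` to one of `B` (`BanachAlgebra.IsBAD.map`). The surjectivity lets
every `b : B` be written as `φ a`, so no approximation is needed.

The quotient homomorphism `π : G → H` with kernel `N` gives such a homomorphism from `ZL¹(G)` to
`ZL¹(H)` (`GroupAlgebra.exists_ZL1_hom`). Let `J g = g ∘ π` (`inflate`), an isometry from `L¹(H)`
to `L¹(G)`, and let `P f = ∫ L n f dn` be the average over `N` (`leftAverage`). The range of `P` lies
in that of `J`, as one sees on continuous functions, and so `T = J⁻¹ P` (`deflate`) is a contraction
with `T J = 1`. Since conjugation preserves the Haar measure of `N`, the operator `P` commutes with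
translations, so that `T (L t f) = L (π t) (T f)`. With Weil's formula `∫ f (h ∘ π) = ∫ (T f) h`,
applied to the `L¹(H)`-valued function `h x = L x (T g)`, this makes `T` multiplicative. The same
tools give `f ∗ J g = J (T f ∗ g)` and `J g ∗ f = J (g ∗ T f)`. Hence `T` maps centre to centre,
because it is surjective, and `J` maps centre to centre, so that `T` remains surjective between the
centres.
-/

noncomputable section

/-! ### Functoriality of the projective tensor product -/

namespace ProjectiveTensor

variable {E F G E' F' : Type*} [NormedAddCommGroup E] [NormedSpace ℂ E]
  [NormedAddCommGroup F] [NormedSpace ℂ F] [NormedAddCommGroup G] [NormedSpace ℂ G]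
  [NormedAddCommGroup E'] [NormedSpace ℂ E'] [NormedAddCommGroup F'] [NormedSpace ℂ F']

theorem norm_tmulL_le (x : E) (y : F) : ‖tmulL E F x y‖ ≤ ‖x‖ * ‖y‖ :=
  (UniformSpace.Completion.norm_coe (algMk x y)).trans_le (norm_algMk_le x y)

/-- Bounded operators on `E ⊗̂ F` are determined by their values on elementary tensors. -/
theorem clm_ext {S T : Proj E F →L[ℂ] G}
    (h : ∀ x y, S (tmulL E F x y) = T (tmulL E F x y)) : S = T := by
  have hd : DenseRange ((↑) : Alg E F → Proj E F) := UniformSpace.Completion.denseRange_coe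
  refine ContinuousLinearMap.coeFn_injective (hd.equalizer S.continuous T.continuous ?_)
  have key : S.toLinearMap ∘ₗ (UniformSpace.Completion.toComplL :
        Alg E F →L[ℂ] Proj E F).toLinearMap =
      T.toLinearMap ∘ₗ (UniformSpace.Completion.toComplL :
        Alg E F →L[ℂ] Proj E F).toLinearMap :=
    TensorProduct.ext' (R := ℂ) (M := E) (N := F) h
  funext u
  exact LinearMap.congr_fun key u

theorem norm_lift_le [CompleteSpace G] (B : E →L[ℂ] F →L[ℂ] G) (u : Proj E F) :
    ‖lift B u‖ ≤ ‖B‖ * ‖u‖ := by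
  induction u using UniformSpace.Completion.induction_on with
  | hp => exact isClosed_le (by fun_prop) (by fun_prop)
  | ih u =>
    have h : lift B (u : Proj E F) = algLift B u :=
      ContinuousLinearMap.extend_eq _ (UniformSpace.Completion.denseRange_coe)
        (UniformSpace.Completion.isUniformInducing_coe _) u
    rw [h, UniformSpace.Completion.norm_coe]
    exact norm_algLift_le B u

/-- The operator `φ ⊗ ψ : E ⊗̂ F → E' ⊗̂ F'`, `x ⊗ y ↦ φ x ⊗ ψ y`. -/
def map (φ : E →L[ℂ] E') (ψ : F →L[ℂ] F') : Proj E F →L[ℂ] Proj E' F' :=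
  lift ((tmulL E' F').bilinearComp φ ψ)

theorem map_tmulL (φ : E →L[ℂ] E') (ψ : F →L[ℂ] F') (x : E) (y : F) :
    map φ ψ (tmulL E F x y) = tmulL E' F' (φ x) (ψ y) := by
  simp [map, lift_tmulL]

theorem norm_map_le (φ : E →L[ℂ] E') (ψ : F →L[ℂ] F') (u : Proj E F) :
    ‖map φ ψ u‖ ≤ ‖φ‖ * ‖ψ‖ * ‖u‖ := by
  refine (norm_lift_le _ u).trans (mul_le_mul_of_nonneg_right ?_ (norm_nonneg u))
  refine ContinuousLinearMap.opNorm_le_bound₂ _ (by positivity) fun x y => ?_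
  refine (norm_tmulL_le (φ x) (ψ y)).trans ?_
  calc ‖φ x‖ * ‖ψ y‖ ≤ (‖φ‖ * ‖x‖) * (‖ψ‖ * ‖y‖) := by
        gcongr <;> exact ContinuousLinearMap.le_opNorm _ _
    _ = ‖φ‖ * ‖ψ‖ * ‖x‖ * ‖y‖ := by ring

end ProjectiveTensor

/-! ### Amenability along surjective homomorphisms -/

namespace BanachAlgebra

open ProjectiveTensor

universe u

variable {A B : Type u} [NonUnitalNormedRing A] [NormedSpace ℂ A] [IsScalarTower ℂ A A]
  [SMulCommClass ℂ A A] [NonUnitalNormedRing B] [NormedSpace ℂ B] [IsScalarTower ℂ B B]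
  [SMulCommClass ℂ B B] {φ : A →L[ℂ] B}

theorem leftAct_map (hφ : ∀ a b, φ (a * b) = φ a * φ b) (a : A) (u : Proj A A) :
    leftAct (φ a) (map φ φ u) = map φ φ (leftAct a u) := by
  refine DFunLike.congr_fun (clm_ext (S := leftAct (φ a) ∘L map φ φ)
    (T := map φ φ ∘L leftAct a) fun x y => ?_) u
  simp [map_tmulL, leftAct_tmulL, hφ]

theorem rightAct_map (hφ : ∀ a b, φ (a * b) = φ a * φ b) (a : A) (u : Proj A A) :
    rightAct (φ a) (map φ φ u) = map φ φ (rightAct a u) := by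
  refine DFunLike.congr_fun (clm_ext (S := rightAct (φ a) ∘L map φ φ)
    (T := map φ φ ∘L rightAct a) fun x y => ?_) u
  simp [map_tmulL, rightAct_tmulL, hφ]

variable [CompleteSpace A] [CompleteSpace B]

theorem mulMap_map (hφ : ∀ a b, φ (a * b) = φ a * φ b) (u : Proj A A) :
    mulMap B (map φ φ u) = φ (mulMap A u) := by
  refine DFunLike.congr_fun (clm_ext (S := mulMap B ∘L map φ φ)
    (T := φ ∘L mulMap A) fun x y => ?_) u
  simp [map_tmulL, mulMap_tmulL, hφ]

/-- A surjective bounded homomorphism carries bounded approximate diagonals to bounded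
approximate diagonals. -/
theorem IsBAD.map (hφ : ∀ a b, φ (a * b) = φ a * φ b) (hs : Function.Surjective φ)
    {ι : Type*} [Preorder ι] {μ : ι → Proj A A} (hμ : IsBAD μ) :
    IsBAD fun i => ProjectiveTensor.map φ φ (μ i) where
  bounded := by
    obtain ⟨C, hC⟩ := hμ.bounded
    exact ⟨‖φ‖ * ‖φ‖ * C, fun i => (norm_map_le φ φ _).trans (by gcongr; exact hC i)⟩
  mulMap_mul b := by
    obtain ⟨a, rfl⟩ := hs b
    simpa only [mulMap_map hφ, hφ, Function.comp_def] using
      (φ.continuous.tendsto a).comp (hμ.mulMap_mul a)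
  mul_mulMap b := by
    obtain ⟨a, rfl⟩ := hs b
    simpa only [mulMap_map hφ, hφ, Function.comp_def] using
      (φ.continuous.tendsto a).comp (hμ.mul_mulMap a)
  comm b := by
    obtain ⟨a, rfl⟩ := hs b
    have h := ((ProjectiveTensor.map φ φ).continuous.tendsto 0).comp (hμ.comm a)
    simpa only [leftAct_map hφ, rightAct_map hφ, Function.comp_def, map_sub, map_zero] using h

theorem IsAmenable.of_surjective (hφ : ∀ a b, φ (a * b) = φ a * φ b)
    (hs : Function.Surjective φ) (hA : IsAmenable A) : IsAmenable B := by
  obtain ⟨ι, i₁, i₂, i₃, μ, hμ⟩ := hA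
  exact ⟨ι, i₁, i₂, i₃, _, hμ.map hφ hs⟩

/-- The amenability constant does not increase along a surjective contractive homomorphism
`φ`, because `φ ⊗ φ` is a contraction. -/
theorem amenabilityConstant_le_of_surjective (hφ : ∀ a b, φ (a * b) = φ a * φ b)
    (hs : Function.Surjective φ) (hn : ‖φ‖ ≤ 1) :
    amenabilityConstant B ≤ amenabilityConstant A := by
  refine le_sInf ?_
  rintro C ⟨ι, i₁, i₂, i₃, μ, hμ, rfl⟩
  have h : amenabilityConstant B ≤ ⨆ i, ‖ProjectiveTensor.map φ φ (μ i)‖ₑ :=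
    sInf_le ⟨ι, i₁, i₂, i₃, _, hμ.map hφ hs, rfl⟩
  refine h.trans (iSup_mono fun i => ?_)
  refine enorm_le_iff_norm_le.2 ((norm_map_le φ φ _).trans ?_)
  exact mul_le_of_le_one_left (norm_nonneg _) (mul_le_one₀ hn (norm_nonneg _) hn)

end BanachAlgebra

/-! ### Averages over a compact subgroup -/

namespace GroupAlgebra

theorem integral_comp_measurePreserving {X Y E : Type*} [MeasurableSpace X] [MeasurableSpace Y]
    [NormedAddCommGroup E] [NormedSpace ℝ E] {μ : Measure X} {ν : Measure Y} {φ : X → Y}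
    (hφ : MeasurePreserving φ μ ν) {f : Y → E} (hf : AEStronglyMeasurable f ν) :
    ∫ x, f (φ x) ∂μ = ∫ y, f y ∂ν := by
  obtain rfl := hφ.map_eq
  exact (integral_map hφ.measurable.aemeasurable hf).symm

section Average

variable {G : Type*} [Group G] [TopologicalSpace G] [IsTopologicalGroup G] [CompactSpace G]
  [MeasurableSpace G] [BorelSpace G] {μ : Measure G} [IsProbabilityMeasure μ] [μ.Regular]
  [μ.IsMulLeftInvariant]

theorem integral_translate_smul {E : Type*} [NormedAddCommGroup E] [NormedSpace ℂ E]
    (s : G) (f : Lp ℂ 1 μ) (k : G → E) :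
    ∫ t, translate s f t • k t ∂μ = ∫ t, f t • k (s * t) ∂μ := by
  have h : (fun t => translate s f t • k t) =ᵐ[μ] fun t => f (s⁻¹ * t) • k t := by
    filter_upwards [translate_ae μ s f] with t ht
    rw [ht]
  rw [integral_congr_ae h,
    ← integral_mul_left_eq_self (fun t => f (s⁻¹ * t) • k t) s]
  simp only [inv_mul_cancel_left]

/-- Integration of an element of `L¹` against a bounded vector-valued continuous function, as a
bounded operator. -/
def integralSmulL {E : Type*} [NormedAddCommGroup E] [NormedSpace ℂ E] (k : C(G, E)) :
    Lp ℂ 1 μ →L[ℂ] E :=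
  have hi (f : Lp ℂ 1 μ) : Integrable (fun t => f t • k t) μ := by
    have h1 : Integrable f μ := L1.integrable_coeFn f
    refine (h1.norm.mul_const ‖k‖).mono'
      (h1.aestronglyMeasurable.smul k.continuous.aestronglyMeasurable_of_compactSpace)
      (Eventually.of_forall fun t => ?_)
    rw [norm_smul]
    gcongr
    exact k.norm_coe_le_norm t
  LinearMap.mkContinuous
    { toFun := fun f => ∫ t, f t • k t ∂μ
      map_add' := fun f g => by
        rw [← integral_add (hi f) (hi g)]
        refine integral_congr_ae ?_
        filter_upwards [Lp.coeFn_add f g] with t ht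
        rw [ht, Pi.add_apply, add_smul]
      map_smul' := fun c f => by
        rw [RingHom.id_apply, ← integral_smul]
        refine integral_congr_ae ?_
        filter_upwards [Lp.coeFn_smul c f] with t ht
        rw [ht, Pi.smul_apply, smul_assoc] } ‖k‖
    (fun f => by
      refine (norm_integral_le_integral_norm _).trans ?_
      rw [L1.norm_eq_integral_norm, mul_comm, ← integral_mul_const]
      refine integral_mono (hi f).norm ((L1.integrable_coeFn f).norm.mul_const _) fun t => ?_
      simp only [norm_smul]
      gcongr
      exact k.norm_coe_le_norm t)

theorem integralSmulL_apply {E : Type*} [NormedAddCommGroup E] [NormedSpace ℂ E] (k : C(G, E))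
    (f : Lp ℂ 1 μ) : integralSmulL k f = ∫ t, f t • k t ∂μ := rfl

variable {N : Subgroup G} [CompactSpace N] (κ : Measure N) [IsProbabilityMeasure κ]

theorem translate_integrable (f : Lp ℂ 1 μ) :
    Integrable (fun n : N => translate (n : G) f) κ :=
  Integrable.of_bound (((translate_continuous μ f).comp
    continuous_subtype_val).aestronglyMeasurable_of_compactSpace) ‖f‖
    (Eventually.of_forall fun n => (translate_norm μ (n : G) f).le)

theorem norm_integral_translate_le (f : Lp ℂ 1 μ) : ‖∫ n : N, translate (n : G) f ∂κ‖ ≤ ‖f‖ := by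
  have h := norm_integral_le_of_norm_le_const (μ := κ) (f := fun n : N => translate (n : G) f)
    (C := ‖f‖) (Eventually.of_forall fun n => (translate_norm μ (n : G) f).le)
  rwa [probReal_univ, mul_one] at h

/-- The average `∫ L n f dn` of the left translates of `f` by the elements of a compact
subgroup, for a probability measure on that subgroup. -/
def leftAverage : Lp ℂ 1 μ →L[ℂ] Lp ℂ 1 μ :=
  LinearMap.mkContinuous
    { toFun := fun f => ∫ n : N, translate (n : G) f ∂κ
      map_add' := fun f g => by
        rw [← integral_add (translate_integrable κ f) (translate_integrable κ g)]
        exact integral_congr_ae (Eventually.of_forall fun n => map_add (translateL μ (n : G)) f g)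
      map_smul' := fun c f => by
        rw [RingHom.id_apply, ← integral_smul]
        exact integral_congr_ae
          (Eventually.of_forall fun n => map_smul (translateL μ (n : G)) c f) } 1
    (fun f => by rw [one_mul]; exact norm_integral_translate_le κ f)

theorem leftAverage_apply (f : Lp ℂ 1 μ) : leftAverage κ f = ∫ n : N, translate (n : G) f ∂κ := rfl

theorem norm_leftAverage_le : ‖leftAverage (μ := μ) κ‖ ≤ 1 :=
  LinearMap.mkContinuous_norm_le _ zero_le_one _

/-- Averaging over `N` does not change the integral against an `N`-invariant function. -/
theorem integral_leftAverage_smul {E : Type*} [NormedAddCommGroup E] [NormedSpace ℂ E]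
    [CompleteSpace E] (k : C(G, E)) (hk : ∀ n : N, ∀ t, k (n * t) = k t) (f : Lp ℂ 1 μ) :
    ∫ t, leftAverage κ f t • k t ∂μ = ∫ t, f t • k t ∂μ := by
  have h1 : ∀ n : N, integralSmulL k (translate (n : G) f) = ∫ t, f t • k t ∂μ := fun n => by
    rw [integralSmulL_apply, integral_translate_smul]
    simp only [hk]
  rw [← integralSmulL_apply, leftAverage_apply,
    ← (integralSmulL k).integral_comp_comm (translate_integrable κ f)]
  simp only [h1, integral_const, probReal_univ, one_smul]

theorem leftAverage_conv (f g : Lp ℂ 1 μ) :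
    leftAverage κ (conv f g) = conv (leftAverage κ f) g := by
  refine Eq.trans ?_ ((convRightL μ g).integral_comp_comm (translate_integrable κ f))
  exact integral_congr_ae (Eventually.of_forall fun n => (translate_conv μ (n : G) f g).symm)

/-- Averaging over a normal subgroup commutes with translations, since conjugation by an element
of `G` preserves the Haar measure of the subgroup. -/
theorem leftAverage_translate [N.Normal] [κ.IsHaarMeasure] (t : G) (f : Lp ℂ 1 μ) :
    leftAverage κ (translate t f) = translate t (leftAverage κ f) := by
  have h1 : translate t (leftAverage κ f) = ∫ n : N, translate (t * n) f ∂κ := by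
    refine ((translateL μ t).integral_comp_comm (translate_integrable κ f)).symm.trans ?_
    exact integral_congr_ae (Eventually.of_forall fun n => translate_translate μ t n f)
  have hc : MeasurePreserving (MulAut.conjNormal t : N ≃* N).toMonoidHom κ κ := by
    refine MonoidHom.measurePreserving (Continuous.subtype_mk ?_ _)
      (MulAut.conjNormal t : N ≃* N).surjective rfl
    exact (continuous_const.mul continuous_subtype_val).mul continuous_const
  rw [h1, leftAverage_apply]
  refine (integral_comp_measurePreserving hc
    (translate_integrable κ (translate t f)).aestronglyMeasurable).symm.trans ?_
  refine integral_congr_ae (Eventually.of_forall fun n => ?_)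
  have h : ((MulAut.conjNormal t n : N) : G) * t = t * n := by
    rw [MulAut.conjNormal_apply, inv_mul_cancel_right]
  exact (translate_translate μ _ t f).trans (congrArg (translate · f) h)

/-- The average of a continuous function is again (the class of) a continuous function, and that
function is pointwise invariant under the subgroup. -/
theorem exists_leftAverage_toLp [κ.IsMulLeftInvariant] (f : C(G, ℂ)) :
    ∃ F : C(G, ℂ), (∀ n : N, ∀ s, F (n * s) = F s) ∧
      leftAverage κ (ContinuousMap.toLp 1 μ ℂ f) = ContinuousMap.toLp 1 μ ℂ F := by
  -- The average is formed in `C(G, ℂ)`, where evaluation at a point commutes with the integral.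
  let Φ : C(N, C(G, ℂ)) :=
    ContinuousMap.curry ⟨fun p : N × G => f ((p.1 : G)⁻¹ * p.2), by fun_prop⟩
  have hΦ : Integrable Φ κ := Integrable.of_bound
    Φ.continuous.aestronglyMeasurable_of_compactSpace ‖Φ‖
    (Eventually.of_forall Φ.norm_coe_le_norm)
  have hF : ∀ s, (∫ n, Φ n ∂κ) s = ∫ n : N, f ((n : G)⁻¹ * s) ∂κ := fun s =>
    ((ContinuousMap.evalCLM ℂ s).integral_comp_comm hΦ).symm
  refine ⟨∫ n, Φ n ∂κ, fun m s => ?_, ?_⟩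
  · rw [hF, hF, ← integral_mul_left_eq_self _ m]
    simp [mul_assoc]
  · rw [leftAverage_apply, ← (ContinuousMap.toLp 1 μ ℂ).integral_comp_comm hΦ]
    refine integral_congr_ae (Eventually.of_forall fun n => Lp.ext ?_)
    have hn := (measurePreserving_mul_left μ (n : G)⁻¹).quasiMeasurePreserving.ae_eq_comp
      (ContinuousMap.coeFn_toLp (p := 1) (𝕜 := ℂ) μ f)
    filter_upwards [translate_ae μ (n : G) (ContinuousMap.toLp 1 μ ℂ f), hn,
      ContinuousMap.coeFn_toLp (p := 1) (𝕜 := ℂ) μ (Φ n)] with s h1 h2 h3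
    rw [h1, h3]
    exact h2

end Average

/-! ### The group algebra of a quotient -/

section Quotient

variable {G H : Type*} [Group G] [TopologicalSpace G] [IsTopologicalGroup G] [CompactSpace G]
  [MeasurableSpace G] [BorelSpace G] {μ : Measure G} [IsProbabilityMeasure μ] [μ.Regular]
  [μ.IsMulLeftInvariant]
  [Group H] [TopologicalSpace H] [IsTopologicalGroup H] [CompactSpace H]
  [MeasurableSpace H] [BorelSpace H] {ν : Measure H} [IsProbabilityMeasure ν] [ν.Regular]
  [ν.IsMulLeftInvariant] {π : G →* H} (hπ : MeasurePreserving π μ ν)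

/-- The isometric embedding `g ↦ g ∘ π` of `L¹(H)` into `L¹(G)`. -/
def inflate : Lp ℂ 1 ν →ₗᵢ[ℂ] Lp ℂ 1 μ := Lp.compMeasurePreservingₗᵢ ℂ π hπ

theorem inflate_ae (g : Lp ℂ 1 ν) : inflate hπ g =ᵐ[μ] g ∘ π :=
  Lp.coeFn_compMeasurePreserving g hπ

theorem translate_inflate (t : G) (g : Lp ℂ 1 ν) :
    translate t (inflate hπ g) = inflate hπ (translate (π t) g) := by
  refine Lp.ext ?_
  have h1 := (measurePreserving_mul_left μ t⁻¹).quasiMeasurePreserving.ae_eq_comp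
    (inflate_ae hπ g)
  have h2 := hπ.quasiMeasurePreserving.ae_eq_comp (translate_ae ν (π t) g)
  filter_upwards [translate_ae μ t (inflate hπ g), inflate_ae hπ (translate (π t) g), h1, h2]
    with s e1 e2 e3 e4
  rw [e1, e2, e4]
  refine e3.trans ?_
  simp

variable [CompactSpace π.ker] (κ : Measure π.ker) [IsProbabilityMeasure κ]

theorem leftAverage_inflate (g : Lp ℂ 1 ν) : leftAverage κ (inflate hπ g) = inflate hπ g := by
  have h : ∀ n : π.ker, translate (n : G) (inflate hπ g) = inflate hπ g := fun n => by
    rw [translate_inflate, (MonoidHom.mem_ker).1 n.2]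
    congr 1
    simp [translate]
  simp [leftAverage_apply, h]

variable [κ.IsHaarMeasure]

/-- Averages over `ker π` are functions on `H`. For a continuous function the average descends to
a continuous function; in general one approximates, the range of `inflate` being closed. -/
theorem leftAverage_mem_range (hq : IsQuotientMap π) (f : Lp ℂ 1 μ) :
    leftAverage κ f ∈ LinearMap.range (inflate hπ).toLinearMap := by
  have hcl : IsClosed {f : Lp ℂ 1 μ | leftAverage κ f ∈ Set.range (inflate hπ)} :=
    (inflate hπ).isometry.isClosedEmbedding.isClosed_range.preimage (leftAverage κ).continuous
  have hd := ContinuousMap.toLp_denseRange ℂ μ (p := 1) ℂ ENNReal.one_ne_top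
  refine hd.induction_on (p := fun f => leftAverage κ f ∈ Set.range (inflate hπ)) f hcl fun f => ?_
  obtain ⟨F, hF, h⟩ := exists_leftAverage_toLp (μ := μ) κ f
  have hfac : Function.FactorsThrough F π := fun a b hab => by
    have hk : a * b⁻¹ ∈ π.ker := by rw [MonoidHom.mem_ker, map_mul, hab, map_inv, mul_inv_cancel]
    simpa using hF ⟨_, hk⟩ b
  rw [h]
  have hq' : IsQuotientMap (⟨π, hq.continuous⟩ : C(G, H)) := hq
  let F' : C(H, ℂ) := hq'.lift F hfac
  refine ⟨ContinuousMap.toLp 1 ν ℂ F', Lp.ext ?_⟩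
  have h1 := hπ.quasiMeasurePreserving.ae_eq_comp
    (ContinuousMap.coeFn_toLp (p := 1) (𝕜 := ℂ) ν F')
  filter_upwards [inflate_ae hπ (ContinuousMap.toLp 1 ν ℂ F'), h1,
    ContinuousMap.coeFn_toLp (p := 1) (𝕜 := ℂ) μ F] with s e1 e2 e3
  rw [e1, e3, e2]
  exact DFunLike.congr_fun (hq'.lift_comp F hfac) s

variable (hq : IsQuotientMap π)

/-- The quotient map `L¹(G) → L¹(H)`, which integrates a function over the cosets of `ker π`. It is
encoded as the average over `ker π`, pulled back along the isometry `inflate`; no choice of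
representatives and no disintegration of measures is needed. -/
def deflate : Lp ℂ 1 μ →L[ℂ] Lp ℂ 1 ν :=
  (inflate hπ).equivRange.symm.toLinearIsometry.toContinuousLinearMap ∘L
    (leftAverage κ).codRestrict _ (leftAverage_mem_range hπ κ hq)

theorem inflate_deflate (f : Lp ℂ 1 μ) : inflate hπ (deflate hπ κ hq f) = leftAverage κ f :=
  congrArg Subtype.val ((inflate hπ).equivRange.apply_symm_apply
    ⟨leftAverage κ f, leftAverage_mem_range hπ κ hq f⟩)

theorem norm_deflate_le (f : Lp ℂ 1 μ) : ‖deflate hπ κ hq f‖ ≤ ‖f‖ := by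
  rw [← (inflate hπ).norm_map, inflate_deflate]
  simpa using (leftAverage κ).le_of_opNorm_le (norm_leftAverage_le κ) f

theorem deflate_inflate (g : Lp ℂ 1 ν) : deflate hπ κ hq (inflate hπ g) = g :=
  (inflate hπ).injective <| by rw [inflate_deflate, leftAverage_inflate]

theorem deflate_translate (t : G) (f : Lp ℂ 1 μ) :
    deflate hπ κ hq (translate t f) = translate (π t) (deflate hπ κ hq f) :=
  (inflate hπ).injective <| by
    rw [inflate_deflate, ← translate_inflate, inflate_deflate, leftAverage_translate]

/-- Weil's formula: `∫ f (h ∘ π)` over `G` is `∫ (deflate f) h` over `H`. -/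
theorem integral_deflate_smul {E : Type*} [NormedAddCommGroup E] [NormedSpace ℂ E]
    [CompleteSpace E] {h : H → E} (hh : Continuous h) (f : Lp ℂ 1 μ) :
    ∫ x, deflate hπ κ hq f x • h x ∂ν = ∫ t, f t • h (π t) ∂μ := by
  have hm : AEStronglyMeasurable (fun x => deflate hπ κ hq f x • h x) ν :=
    (L1.integrable_coeFn (deflate hπ κ hq f)).aestronglyMeasurable.smul
      hh.aestronglyMeasurable_of_compactSpace
  have h1 := integral_leftAverage_smul κ (⟨fun t => h (π t), hh.comp hq.continuous⟩ : C(G, E))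
    (fun n t => by simp [(MonoidHom.mem_ker).1 n.2]) f
  refine (integral_comp_measurePreserving hπ hm).symm.trans (Eq.trans ?_ h1)
  rw [← inflate_deflate hπ κ hq]
  refine integral_congr_ae ?_
  filter_upwards [inflate_ae hπ (deflate hπ κ hq f)] with t ht
  rw [ht]
  rfl

/-- `deflate` is a homomorphism: it moves inside the Bochner integral `f ∗ g = ∫ f t • L t g dt`,
intertwines the translations, and Weil's formula turns the integral over `G` into one over `H`. -/
theorem deflate_conv (f g : Lp ℂ 1 μ) :
    deflate hπ κ hq (conv f g) = conv (deflate hπ κ hq f) (deflate hπ κ hq g) := by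
  refine ((deflate hπ κ hq).integral_comp_comm (conv_integrable μ f g)).symm.trans ?_
  simp only [map_smul, deflate_translate]
  exact (integral_deflate_smul hπ κ hq (translate_continuous ν (deflate hπ κ hq g)) f).symm

theorem conv_inflate (f : Lp ℂ 1 μ) (g : Lp ℂ 1 ν) :
    conv f (inflate hπ g) = inflate hπ (conv (deflate hπ κ hq f) g) := by
  have h : conv (deflate hπ κ hq f) g = ∫ t, f t • translate (π t) g ∂μ :=
    integral_deflate_smul hπ κ hq (translate_continuous ν g) f
  rw [h, ← (inflate hπ).integral_comp_comm]
  simp only [map_smul, ← translate_inflate]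
  rfl

/-- `inflate g ∗ f` is already `ker π`-invariant, hence equal to its average, on which `deflate`
acts as a homomorphism. -/
theorem inflate_conv (g : Lp ℂ 1 ν) (f : Lp ℂ 1 μ) :
    conv (inflate hπ g) f = inflate hπ (conv g (deflate hπ κ hq f)) := by
  have h : leftAverage κ (conv (inflate hπ g) f) = conv (inflate hπ g) f := by
    rw [leftAverage_conv, leftAverage_inflate]
  rw [← h, ← inflate_deflate hπ κ hq, deflate_conv, deflate_inflate]

end Quotient

/-! ### Centres of group algebras -/

/-- Restriction to the centres of a contractive homomorphism `T : L¹(G) → L¹(H)` that has a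
section `J` with `f ∗ J g = J (T f ∗ g)` and `J g ∗ f = J (g ∗ T f)`. It is surjective because `J`
maps central elements to central elements. -/
theorem exists_center_hom {G H : Type*} [Group G] [TopologicalSpace G] [IsTopologicalGroup G]
    [CompactSpace G] [Group H] [TopologicalSpace H] [IsTopologicalGroup H] [CompactSpace H]
    (T : GroupL1 G →L[ℂ] GroupL1 H) (J : GroupL1 H → GroupL1 G)
    (hT : ∀ f g, T (f * g) = T f * T g) (hn : ∀ f, ‖T f‖ ≤ ‖f‖) (hTJ : ∀ g, T (J g) = g)
    (hl : ∀ f g, f * J g = J (T f * g)) (hr : ∀ f g, J g * f = J (g * T f)) :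
    ∃ φ : ZL1 G →L[ℂ] ZL1 H, (∀ a b, φ (a * b) = φ a * φ b) ∧ Function.Surjective φ ∧
      ‖φ‖ ≤ 1 := by
  have hc (f : ZL1 G) : T f ∈ NonUnitalSubalgebra.center ℂ (GroupL1 H) := by
    refine NonUnitalSubalgebra.mem_center_iff.2 fun g => ?_
    have h := NonUnitalSubalgebra.mem_center_iff.1 f.2 (J g)
    simpa only [hT, hTJ] using congrArg T h
  refine ⟨LinearMap.mkContinuous
    { toFun := fun f => ⟨T f, hc f⟩
      map_add' := fun f g => Subtype.ext (map_add T (f : GroupL1 G) g)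
      map_smul' := fun c f => Subtype.ext (map_smul T c (f : GroupL1 G)) } 1
    (fun f => by rw [one_mul]; exact hn f), fun f g => Subtype.ext (hT f g), fun g => ?_,
    LinearMap.mkContinuous_norm_le _ zero_le_one _⟩
  refine ⟨⟨J g, NonUnitalSubalgebra.mem_center_iff.2 fun f => ?_⟩, Subtype.ext (hTJ g)⟩
  rw [hl, hr, NonUnitalSubalgebra.mem_center_iff.1 g.2]

/-- A homomorphism `π : G → H` that is a topological quotient map induces a surjective contractive
homomorphism `ZL¹(G) → ZL¹(H)`. -/
theorem exists_ZL1_hom {G H : Type*} [Group G] [TopologicalSpace G] [IsTopologicalGroup G]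
    [CompactSpace G] [T2Space G] [Group H] [TopologicalSpace H] [IsTopologicalGroup H]
    [CompactSpace H] {π : G →* H} (hq : IsQuotientMap π) [CompactSpace π.ker] :
    ∃ φ : ZL1 G →L[ℂ] ZL1 H, (∀ a b, φ (a * b) = φ a * φ b) ∧ Function.Surjective φ ∧
      ‖φ‖ ≤ 1 := by
  let : MeasurableSpace G := borel G
  have : BorelSpace G := ⟨rfl⟩
  let : MeasurableSpace H := borel H
  have : BorelSpace H := ⟨rfl⟩
  have : (haarProb G).IsHaarMeasure := Measure.isHaarMeasure_haarMeasure ⊤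
  have : (haarProb H).IsHaarMeasure := Measure.isHaarMeasure_haarMeasure ⊤
  have hπ : MeasurePreserving π (haarProb G) (haarProb H) :=
    MonoidHom.measurePreserving hq.continuous hq.surjective (by simp)
  let κ : Measure π.ker := Measure.haarMeasure ⊤
  have : IsProbabilityMeasure κ := ⟨Measure.haarMeasure_self⟩
  exact exists_center_hom (deflate hπ κ hq) (inflate hπ) (deflate_conv hπ κ hq)
    (norm_deflate_le hπ κ hq) (deflate_inflate hπ κ hq) (conv_inflate hπ κ hq)
    (fun f g => inflate_conv hπ κ hq g f)

end GroupAlgebra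

end

theorem corollary1p3 {G : Type*} [Group G] [TopologicalSpace G] [IsTopologicalGroup G]
    [CompactSpace G] [T2Space G] (N : Subgroup G) [N.Normal] (hN : IsClosed (N : Set G)) :
    BanachAlgebra.amenabilityConstant (GroupAlgebra.ZL1 (G ⧸ N)) ≤
        BanachAlgebra.amenabilityConstant (GroupAlgebra.ZL1 G) ∧
      (BanachAlgebra.IsAmenable (GroupAlgebra.ZL1 G) → BanachAlgebra.IsAmenable (GroupAlgebra.ZL1 (G ⧸ N))) := by
  have : CompactSpace (QuotientGroup.mk' N).ker := by
    rw [QuotientGroup.ker_mk']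
    exact isCompact_iff_compactSpace.1 hN.isCompact
  obtain ⟨φ, hφ, hs, hn⟩ := GroupAlgebra.exists_ZL1_hom (π := QuotientGroup.mk' N)
    (QuotientGroup.isQuotientMap_mk N)
  exact ⟨BanachAlgebra.amenabilityConstant_le_of_surjective hφ hs hn,
    BanachAlgebra.IsAmenable.of_surjective hφ hs⟩
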